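/- Let $d,n\ge 1$ and $N,k,N_g\ge 0$ be integers. Let $\hat U(\theta)=\prod_{l=1}^{N_g}\hat u_l(\theta)$, $\theta\in\Theta$, be a parametrized circuit on $N$ qudits of dimension $d$, in which every gate $\hat u_l(\theta)$ is a unitary acting on at most $k$ qudits (the set of qudits of the $l$-th gate does not depend on $\theta$), and all but $N_{gt}\le N_g$ of the gates are fixed, i.e. independent of $\theta$. Let $O$ be a Hermitian observable on $(\mathbb C^d)^{\otimes N}$ with operator norm $\|O\|$, let $x\mapsto\rho_x$ be a measurable encoding of the data $x\in\mathcal X$ into density operators, and let $h_\theta(x)=\operatorname{Tr}\big(\hat U(\theta)^\dagger O\,\hat U(\theta)\rho_x\big)$. Let $\mu$ be a probability distribution on $\mathcal X\times\mathcal Y$, and let $\ell(h,y)$ be a measurable loss that, for each $y\in\mathcal Y$, is $L_1$-Lipschitz in $h$ and satisfies $|\ell(h,y)|\le C_1$ for $h\in[-\|O\|,\|O\|]$. Put $\mathcal R(\theta)=\mathbb E_{(x,y)\sim\mu}\,\ell(h_\theta(x),y)$ and, for a sample $S=((x_i,y_i))_{i=1}^n$, $\hat{\mathcal R}_S(\theta)=\frac1n\sum_{i=1}^n\ell(h_\theta(x_i),y_i)$.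 Then for every $\delta\in(0,1)$, with probability at least $1-\delta$ over $S\sim\mu^{n}$, every learning algorithm $\mathcal A$ that maps samples to parameters in $\Theta$ satisfies $$\mathcal R(\mathcal A(S))-\hat{\mathcal R}_S(\mathcal A(S))\;\le\;\frac{8L_1}{\sqrt n}+\frac{24L_1}{\sqrt n}\,d^{k}\sqrt{N_{gt}}\;\max(1,\|O\|)\Big(\ln^{+}\!\big(7\sqrt n\,N_{gt}\|O\|\big)+1\Big)+3C_1\sqrt{\frac{\ln(1/\delta)}{2n}},$$ where $\ln^+ t=\max(0,\ln t)$ for $t>0$ and $\ln^+0=0$. In particular, for bounded $\|O\|$ and fixed $\delta$ the gap is $\tilde{\mathcal O}\Big(\frac{8L_1+C_1+24L_1d^k\sqrt{N_{gt}}}{\sqrt n}\Big)$, with a hidden factor that is logarithmic in $nN_{gt}$. -/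

import Mathlib

open MeasureTheory
open scoped ComplexOrder

noncomputable section

namespace QNN

/-- Computational basis labels of `N` qudits of local dimension `d`; the Hilbert space
`(ℂ^d)^{⊗N}` is `ℂ^(Basis d N)`, of dimension `d ^ N`. -/
abbrev Basis (d N : ℕ) : Type := Fin N → Fin d

/-- Operators on `N` qudits, i.e. complex `d^N × d^N` matrices. -/
abbrev Operator (d N : ℕ) : Type := Matrix (Basis d N) (Basis d N) ℂ

/-- Unitary operators on the qudits listed in `s`, i.e. the group `U(d ^ |s|)`. -/
abbrev GateOn (d : ℕ) {N : ℕ} (s : Finset (Fin N)) : Type :=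
  Matrix.unitaryGroup ({i // i ∈ s} → Fin d) ℂ

/-- The operator `u ⊗ 1` on `N` qudits, where `u` acts on the qudits in `s` and the identity
on all other qudits. -/
def localOp {d N : ℕ} (s : Finset (Fin N))
    (u : Matrix ({i // i ∈ s} → Fin d) ({i // i ∈ s} → Fin d) ℂ) : Operator d N :=
  Matrix.of fun a b => if ∀ i, i ∉ s → a i = b i then u (fun i => a i.1) (fun i => b i.1) else 0

/-- A parametrized circuit on `N` qudits with `Ng` gates, each acting on at most `k` qudits.
The gates outside `trainable` are fixed: they do not depend on the parameter. -/
structure Ansatz (d N k Ng : ℕ) (Θ : Type*) where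
  /-- the qudits on which the `l`-th gate acts -/
  support : Fin Ng → Finset (Fin N)
  card_support_le : ∀ l, (support l).card ≤ k
  /-- the `l`-th gate `u_l(θ)` -/
  gate : (l : Fin Ng) → Θ → GateOn d (support l)
  /-- the trainable gates -/
  trainable : Finset (Fin Ng)
  fixed : ∀ l, l ∉ trainable → ∀ θ θ' : Θ, gate l θ = gate l θ'

/-- The number of trainable gates. -/
def Ansatz.numTrainable {d N k Ng : ℕ} {Θ : Type*} (c : Ansatz d N k Ng Θ) : ℕ :=
  c.trainable.card

/-- The circuit `U(θ) = u_1(θ) u_2(θ) ⋯ u_{Ng}(θ)`. -/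
def Ansatz.circuit {d N k Ng : ℕ} {Θ : Type*} (c : Ansatz d N k Ng Θ) (θ : Θ) : Operator d N :=
  (List.ofFn fun l => localOp (c.support l) (c.gate l θ).1).prod

/-- Operator norm on the Euclidean space `ℂ^(d^N)`. -/
def opNorm {d N : ℕ} (O : Operator d N) : ℝ :=
  ‖Matrix.toEuclideanCLM (n := Basis d N) (𝕜 := ℂ) O‖

/-- Density operators (quantum states). -/
def IsState {d N : ℕ} (ρ : Operator d N) : Prop :=
  ρ.PosSemidef ∧ ρ.trace = 1

/-- The hypothesis `h_θ(x) = Tr(U(θ)† O U(θ) ρ_x)`. For Hermitian `O` and `ρ_x` the trace is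
a real number, so taking the real part only changes its type. -/
def hypothesis {d N k Ng : ℕ} {Θ X : Type*} (c : Ansatz d N k Ng Θ) (O : Operator d N)
    (ρ : X → Operator d N) (θ : Θ) (x : X) : ℝ :=
  (((c.circuit θ).conjTranspose * O * c.circuit θ * ρ x).trace).re

/-- The expected risk `E_{(x,y) ∼ μ} ℓ(h(x), y)`. -/
def expectedRisk {X Y : Type*} [MeasurableSpace X] [MeasurableSpace Y] (μ : Measure (X × Y))
    (loss : ℝ → Y → ℝ) (h : X → ℝ) : ℝ :=
  ∫ z, loss (h z.1) z.2 ∂μ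

/-- The empirical risk `(1/n) ∑ i, ℓ(h(x_i), y_i)`. -/
def empiricalRisk {X Y : Type*} {n : ℕ} (S : Fin n → X × Y)
    (loss : ℝ → Y → ℝ) (h : X → ℝ) : ℝ :=
  (1 / (n : ℝ)) * ∑ i, loss (h (S i).1) (S i).2

end QNN

end

/-! The parameter set enters only through the trainable gates, a bounded subset of a space of real
dimension at most 2 · N_gt · d^(2k), so a single-scale net suffices, without chaining. A volume
argument gives a finite net of gates; telescoping the product of contractions makes the hypotheses
Lipschitz in these gates, so it is also a uniform 4/√n-net of hypotheses. Passing from any parameter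
to its net point changes the gap by at most 8L₁/√n.

A plain union bound over the net would multiply the entropy by C₁. Instead each loss is split as
ℓ(h_θ, y) = ℓ(0, y) + (ℓ(h_θ, y) − ℓ(0, y)). The first part is common to all θ, and the second is
bounded by L₁‖O‖. By Hölder's inequality inside the Chernoff bound, only the second part pays for
the maximum (`measureReal_exists_ge_add_le`, `measureReal_exists_gt_le`). The entropy is thus
multiplied by L₁ and the confidence term by C₁. -/

namespace QNN

open ProbabilityTheory

/-! ### Sub-Gaussian concentration -/

/-- Minus the centred empirical mean of a function bounded by `B` is sub-Gaussian. -/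
theorem hasSubgaussianMGF_integral_sub_mean {Z : Type*} [MeasurableSpace Z] (μ : Measure Z)
    [IsProbabilityMeasure μ] {n : ℕ} (hn : 1 ≤ n) {f : Z → ℝ} (hf : Measurable f) {B : NNReal}
    (hB : ∀ z, |f z| ≤ B) :
    HasSubgaussianMGF (fun S : Fin n → Z => ∫ z, f z ∂μ - (1 / (n : ℝ)) * ∑ i, f (S i))
      ((B / NNReal.sqrt n) ^ 2) (Measure.pi fun _ : Fin n => μ) := by
  have hn0 : (n : ℝ) ≠ 0 := by positivity
  -- Hoeffding's lemma: the values lie in an interval of length 2B, so the parameter is (2B/2)².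
  have h1 : HasSubgaussianMGF (fun z => f z - ∫ z, f z ∂μ) (B ^ 2) μ := by
    have := hasSubgaussianMGF_of_mem_Icc (μ := μ) (a := -(B : ℝ)) (b := B) hf.aemeasurable
      (Filter.Eventually.of_forall fun z => abs_le.mp (hB z))
    convert this using 1
    ext
    simp only [NNReal.coe_pow, NNReal.coe_div, coe_nnnorm, Real.norm_eq_abs, NNReal.coe_ofNat]
    rw [abs_of_nonneg (by linarith [B.coe_nonneg])]
    ring
  have hind : iIndepFun (fun (i : Fin n) (S : Fin n → Z) => f (S i) - ∫ z, f z ∂μ)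
      (Measure.pi fun _ : Fin n => μ) :=
    iIndepFun_pi (μ := fun _ : Fin n => μ) (X := fun _ z => f z - ∫ z, f z ∂μ)
      fun _ => (hf.sub_const _).aemeasurable
  have h2 : ∀ i : Fin n, HasSubgaussianMGF (fun S : Fin n → Z => f (S i) - ∫ z, f z ∂μ) (B ^ 2)
      (Measure.pi fun _ : Fin n => μ) := by
    intro i
    have hmp := measurePreserving_eval (fun _ : Fin n => μ) i
    have := HasSubgaussianMGF.of_map (X := fun z => f z - ∫ z, f z ∂μ) (c := B ^ 2)
      (μ := Measure.pi fun _ : Fin n => μ) (Y := Function.eval i) hmp.measurable.aemeasurable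
      (by rw [hmp.map_eq]; exact h1)
    exact this
  have h3 := (HasSubgaussianMGF.sum_of_iIndepFun hind (s := Finset.univ)
    fun i _ => h2 i).const_mul (-(1 / (n : ℝ)))
  convert h3 using 1
  · funext S
    simp only [Finset.sum_sub_distrib, Finset.sum_const, Finset.card_univ, Fintype.card_fin,
      nsmul_eq_mul]
    field_simp
    ring
  · ext
    change _ = (-(1 / (n : ℝ))) ^ 2 * ((∑ _i : Fin n, B ^ 2 : NNReal) : ℝ)
    simp only [NNReal.coe_pow, NNReal.coe_div, NNReal.coe_mul, Finset.sum_const, Finset.card_univ,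
      Fintype.card_fin, nsmul_eq_mul, NNReal.coe_natCast, Real.coe_sqrt]
    rw [div_pow, Real.sq_sqrt (Nat.cast_nonneg n)]
    field_simp

/-- The Chernoff bound for the maximum of finitely many variables `G + Z i`, where the Hölder
inequality separates the common part `G` from the maximum over `i`. -/
theorem measureReal_exists_ge_add_le {Ω ι : Type*} [MeasurableSpace Ω] {P : Measure Ω}
    [IsProbabilityMeasure P] (F : Finset ι) {G : Ω → ℝ} {Z : ι → Ω → ℝ} {c₀ c₁ : NNReal}
    (hG : HasSubgaussianMGF G c₀ P) (hZ : ∀ i ∈ F, HasSubgaussianMGF (Z i) c₁ P)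
    {p q : ℝ} (hpq : p.HolderConjugate q) {v : ℝ} (hv : v = p * c₀ + q * c₁) (hv0 : 0 < v)
    {s : ℝ} (hs : 0 ≤ s) :
    P.real {ω | ∃ i ∈ F, s ≤ G ω + Z i ω} ≤
      Real.exp (-s ^ 2 / (2 * v)) * (F.card : ℝ) ^ (1 / q) := by
  have hp := hpq.pos
  have hq := hpq.symm.pos
  -- This minimizes the Chernoff exponent v t²/2 − t s.
  set t : ℝ := s / v with ht
  have ht0 : 0 ≤ t := by positivity
  -- The sum replaces the maximum over `F`. The exponent q t makes W^(1/q) dominate every exp(t Z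
  -- i), so the cardinality enters only to the power 1/q.
  set W : Ω → ℝ := fun ω => ∑ i ∈ F, Real.exp (q * t * Z i ω) with hW
  have hW0 : ∀ ω, 0 ≤ W ω := fun ω => Finset.sum_nonneg fun i _ => (Real.exp_pos _).le
  have hWint : Integrable W P :=
    integrable_finsetSum _ fun i hi => (hZ i hi).integrable_exp_mul (q * t)
  have hWle : ∫ ω, W ω ∂P ≤ F.card * Real.exp (c₁ * (q * t) ^ 2 / 2) := by
    rw [hW, integral_finsetSum _ fun i hi => (hZ i hi).integrable_exp_mul (q * t)]
    refine (Finset.sum_le_card_nsmul _ _ _ fun i hi => (hZ i hi).mgf_le (q * t)).trans ?_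
    rw [nsmul_eq_mul]
  have hA : MemLp (fun ω => Real.exp (t * G ω)) (ENNReal.ofReal p) P :=
    hG.memLp_exp_mul t p.toNNReal
  have hBm : MemLp (fun ω => W ω ^ (1 / q)) (ENNReal.ofReal q) P := by
    refine (integrable_norm_rpow_iff ?_ (by simpa using hq) ENNReal.ofReal_ne_top).mp ?_
    · exact (hWint.aestronglyMeasurable.aemeasurable.pow_const _).aestronglyMeasurable
    · refine hWint.congr (Filter.Eventually.of_forall fun ω => ?_)
      simp only [ENNReal.toReal_ofReal hq.le]
      rw [Real.norm_of_nonneg (Real.rpow_nonneg (hW0 ω) _), ← Real.rpow_mul (hW0 ω),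
        one_div_mul_cancel hq.ne', Real.rpow_one]
  have hholder := integral_mul_le_Lp_mul_Lq_of_nonneg (μ := P) hpq
    (f := fun ω => Real.exp (t * G ω)) (g := fun ω => W ω ^ (1 / q))
    (Filter.Eventually.of_forall fun ω => (Real.exp_pos _).le)
    (Filter.Eventually.of_forall fun ω => Real.rpow_nonneg (hW0 ω) _) hA hBm
  have e1 : (∫ ω, Real.exp (t * G ω) ^ p ∂P) ^ (1 / p) ≤ Real.exp (c₀ * p * t ^ 2 / 2) := by
    have h : ∫ ω, Real.exp (t * G ω) ^ p ∂P = mgf G P (p * t) := by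
      unfold mgf
      congr 1
      funext ω
      rw [← Real.exp_mul]
      ring_nf
    rw [h]
    calc mgf G P (p * t) ^ (1 / p) ≤ Real.exp (c₀ * (p * t) ^ 2 / 2) ^ (1 / p) :=
          Real.rpow_le_rpow mgf_nonneg (hG.mgf_le _) (by positivity)
      _ = _ := by
        rw [← Real.exp_mul]
        congr 1
        field_simp
  have e2 : (∫ ω, (W ω ^ (1 / q)) ^ q ∂P) ^ (1 / q) ≤
      (F.card : ℝ) ^ (1 / q) * Real.exp (c₁ * q * t ^ 2 / 2) := by
    have h : ∫ ω, (W ω ^ (1 / q)) ^ q ∂P = ∫ ω, W ω ∂P := by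
      congr 1
      funext ω
      rw [← Real.rpow_mul (hW0 ω), one_div_mul_cancel hq.ne', Real.rpow_one]
    rw [h]
    calc (∫ ω, W ω ∂P) ^ (1 / q) ≤ (F.card * Real.exp (c₁ * (q * t) ^ 2 / 2)) ^ (1 / q) :=
          Real.rpow_le_rpow (integral_nonneg hW0) hWle (by positivity)
      _ = _ := by
        rw [Real.mul_rpow (Nat.cast_nonneg _) (Real.exp_pos _).le, ← Real.exp_mul]
        congr 2
        field_simp
  have hint : Integrable (fun ω => Real.exp (t * G ω) * W ω ^ (1 / q)) P := by
    have : ENNReal.HolderConjugate (ENNReal.ofReal p) (ENNReal.ofReal q) := hpq.ennrealOfReal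
    exact MemLp.integrable_mul hA hBm
  have hmarkov := mul_meas_ge_le_integral_of_nonneg (μ := P)
    (f := fun ω => Real.exp (t * G ω) * W ω ^ (1 / q))
    (Filter.Eventually.of_forall fun ω =>
      mul_nonneg (Real.exp_pos _).le (Real.rpow_nonneg (hW0 ω) _)) hint (Real.exp (t * s))
  have hsub : {ω | ∃ i ∈ F, s ≤ G ω + Z i ω} ⊆
      {ω | Real.exp (t * s) ≤ Real.exp (t * G ω) * W ω ^ (1 / q)} := by
    rintro ω ⟨i, hi, h⟩
    have h1 : Real.exp (q * t * Z i ω) ≤ W ω :=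
      Finset.single_le_sum (f := fun i => Real.exp (q * t * Z i ω))
        (fun j _ => (Real.exp_pos _).le) hi
    have h2 : Real.exp (t * Z i ω) ≤ W ω ^ (1 / q) := by
      calc Real.exp (t * Z i ω) = Real.exp (q * t * Z i ω) ^ (1 / q) := by
            rw [← Real.exp_mul]
            congr 1
            field_simp
        _ ≤ _ := Real.rpow_le_rpow (Real.exp_pos _).le h1 (by positivity)
    calc Real.exp (t * s) ≤ Real.exp (t * (G ω + Z i ω)) :=
          Real.exp_le_exp.mpr (mul_le_mul_of_nonneg_left h ht0)
      _ = Real.exp (t * G ω) * Real.exp (t * Z i ω) := by rw [mul_add, Real.exp_add]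
      _ ≤ _ := mul_le_mul_of_nonneg_left h2 (Real.exp_pos _).le
  have hfin : Real.exp (t * s) * P.real {ω | ∃ i ∈ F, s ≤ G ω + Z i ω} ≤
      Real.exp (c₀ * p * t ^ 2 / 2) *
        ((F.card : ℝ) ^ (1 / q) * Real.exp (c₁ * q * t ^ 2 / 2)) := by
    refine (mul_le_mul_of_nonneg_left (measureReal_mono hsub) (Real.exp_pos _).le).trans ?_
    refine hmarkov.trans (hholder.trans ?_)
    exact mul_le_mul e1 e2 (Real.rpow_nonneg (integral_nonneg fun ω =>
      Real.rpow_nonneg (Real.rpow_nonneg (hW0 ω) _) _) _) (Real.exp_pos _).le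
  have hexp : Real.exp (-s ^ 2 / (2 * v)) =
      (Real.exp (t * s))⁻¹ * (Real.exp (c₀ * p * t ^ 2 / 2) * Real.exp (c₁ * q * t ^ 2 / 2)) := by
    rw [← Real.exp_neg, ← Real.exp_add, ← Real.exp_add]
    congr 1
    have : c₀ * p * t ^ 2 / 2 + c₁ * q * t ^ 2 / 2 = v * t ^ 2 / 2 := by rw [hv]; ring
    rw [this, ht]
    field_simp
    ring
  rw [hexp]
  have := mul_le_mul_of_nonneg_left hfin (inv_nonneg.mpr (Real.exp_pos (t * s)).le)
  rw [inv_mul_cancel_left₀ (Real.exp_pos _).ne'] at this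
  refine this.trans (le_of_eq ?_)
  ring

/-- Concentration of a finite maximum of `G + Z i`, with a confidence term that depends only on
the sub-Gaussian parameter `C` of the sums, and a complexity term that depends only on that of
the `Z i`. -/
theorem measureReal_exists_gt_le {Ω ι : Type*} [MeasurableSpace Ω] {P : Measure Ω}
    [IsProbabilityMeasure P] (F : Finset ι) (hF : F.Nonempty) {G : Ω → ℝ} {Z : ι → Ω → ℝ}
    {C b : NNReal} (hC : 0 < C) (hb : 0 < b ∨ F.card = 1)
    (hG : HasSubgaussianMGF G (C ^ 2) P) (hZ : ∀ i ∈ F, HasSubgaussianMGF (Z i) (b ^ 2) P)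
    (hGZ : ∀ i ∈ F, HasSubgaussianMGF (fun ω => G ω + Z i ω) (C ^ 2) P)
    {δ : ℝ} (hδ0 : 0 < δ) (hδ1 : δ < 1) :
    P.real {ω | ∃ i ∈ F, 4 * b * √(Real.log F.card) + 3 / 2 * C * √(2 * Real.log (1 / δ))
      ≤ G ω + Z i ω} ≤ δ := by
  have hcard : (1 : ℝ) ≤ F.card := by exact_mod_cast hF.card_pos
  have hcard0 : (0 : ℝ) < F.card := by linarith
  have hK : 0 ≤ Real.log F.card := Real.log_nonneg hcard
  have hL : 0 ≤ Real.log (1 / δ) := Real.log_nonneg (by rw [le_div_iff₀ hδ0]; linarith)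
  have hC' : (0 : ℝ) < C := hC
  have hb' : (0 : ℝ) ≤ b := b.coe_nonneg
  set K := Real.log F.card with hKdef
  set L := Real.log (1 / δ) with hLdef
  have hexpL : Real.exp (-L) = δ := by
    rw [hLdef, one_div, Real.log_inv, neg_neg, Real.exp_log hδ0]
  set s := 4 * b * √K + 3 / 2 * C * √(2 * L) with hsdef
  have hs : 0 ≤ s := by positivity
  have hsK := Real.sq_sqrt hK
  have hsL := Real.sq_sqrt (mul_nonneg zero_le_two hL)
  have hcross : 0 ≤ b * √K * (C * √(2 * L)) := by positivity
  by_cases hcase : 8 * (b : ℝ) ^ 2 ≤ C ^ 2 ∧ 0 < b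
  · obtain ⟨h8, hb0⟩ := hcase
    have hb0' : (0 : ℝ) < b := hb0
    -- This choice equalizes p C² and q b². As η ≤ 1/8, their sum v is at most (9/4) C², which is
    -- where the factor 3/2 in `s` comes from. The entropy K is weighted by 1/q = η/(1+η).
    set η : ℝ := b ^ 2 / C ^ 2 with hη
    have hη0 : 0 < η := by positivity
    have hη8 : η ≤ 1 / 8 := by rw [hη, div_le_iff₀ (by positivity)]; linarith
    have hηC : η * C ^ 2 = b ^ 2 := by rw [hη]; field_simp
    have hpq : (1 + η).HolderConjugate ((1 + η) / η) := by
      rw [Real.holderConjugate_iff]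
      refine ⟨by linarith, ?_⟩
      field_simp
    set v : ℝ := 2 * (1 + η) * C ^ 2 with hv
    have hv0 : 0 < v := by positivity
    have hveq : v = (1 + η) * ((C ^ 2 : NNReal) : ℝ) + (1 + η) / η * ((b ^ 2 : NNReal) : ℝ) := by
      push_cast
      rw [← hηC, hv]
      field_simp
      ring
    refine (measureReal_exists_ge_add_le F hG hZ hpq hveq hv0 hs).trans ?_
    rw [Real.rpow_def_of_pos hcard0, ← Real.exp_add, ← hexpL]
    refine Real.exp_le_exp.mpr ?_
    have hkey : 2 * v * L + K * (4 * b ^ 2) ≤ s ^ 2 := by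
      have h1 : s ^ 2 = 16 * b ^ 2 * √K ^ 2 + 9 / 4 * C ^ 2 * √(2 * L) ^ 2
          + 12 * (b * √K * (C * √(2 * L))) := by rw [hsdef]; ring
      have h2 : v * L ≤ 9 / 4 * C ^ 2 * L :=
        mul_le_mul_of_nonneg_right (by rw [hv]; nlinarith [sq_nonneg (C : ℝ)]) hL
      have h3 : 0 ≤ (b : ℝ) ^ 2 * K := by positivity
      rw [h1, hsK, hsL]
      linarith
    have hq : K * (1 / ((1 + η) / η)) = K * (4 * b ^ 2) / (2 * v) := by
      rw [← hηC, hv]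
      field_simp
      ring
    rw [← hKdef, hq, ← add_div, div_le_iff₀ (by positivity)]
    linarith
  -- Here C² K ≤ 8 b² K, so the plain union bound is affordable: 2C² K ≤ (4b)² K accounts for the
  -- factor 4 in `s`.
  · have hCb : (C : ℝ) ^ 2 * K ≤ 8 * b ^ 2 * K := by
      rcases hb with hb0 | h1
      · have : (C : ℝ) ^ 2 ≤ 8 * b ^ 2 := by
          by_contra h
          exact hcase ⟨by linarith, hb0⟩
        exact mul_le_mul_of_nonneg_right this hK
      · have : K = 0 := by rw [hKdef, h1]; simp
        simp [this]
    have hset : {ω | ∃ i ∈ F, s ≤ G ω + Z i ω} = ⋃ i ∈ F, {ω | s ≤ G ω + Z i ω} := by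
      ext ω
      simp
    rw [hset]
    refine (measureReal_biUnion_finset_le _ _).trans ?_
    refine (Finset.sum_le_card_nsmul _ _ _ fun i hi => (hGZ i hi).measure_ge_le hs).trans ?_
    rw [nsmul_eq_mul, ← Real.exp_log hcard0, ← Real.exp_add, ← hexpL]
    refine Real.exp_le_exp.mpr ?_
    have hkey : (K + L) * (2 * C ^ 2) ≤ s ^ 2 := by
      have h1 : s ^ 2 = 16 * b ^ 2 * √K ^ 2 + 9 / 4 * C ^ 2 * √(2 * L) ^ 2
          + 12 * (b * √K * (C * √(2 * L))) := by rw [hsdef]; ring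
      have h2 : 0 ≤ (C : ℝ) ^ 2 * L := by positivity
      rw [h1, hsK, hsL]
      linarith
    rw [← hKdef, neg_div, NNReal.coe_pow]
    have := (le_div_iff₀ (by positivity : (0 : ℝ) < 2 * C ^ 2)).mpr hkey
    linarith

/-! ### Covering numbers by volume -/

open Module Metric in
/-- Volume bound for the cardinality of an `ε`-separated family in the unit ball. -/
theorem card_le_of_separated {E ι : Type*} [NormedAddCommGroup E] [NormedSpace ℝ E]
    [FiniteDimensional ℝ E] (f : ι → E) (hf : ∀ i, ‖f i‖ ≤ 1) {ε : ℝ} (hε : 0 < ε) (F : Finset ι)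
    (h : (F : Set ι).Pairwise fun i j => ε < ‖f i - f j‖) :
    (F.card : ℝ) ≤ (1 + 2 / ε) ^ finrank ℝ E := by
  borelize E
  let μ : Measure E := Measure.addHaar
  have hε2 : 0 < ε / 2 := by positivity
  have hρ : 0 < 1 + ε / 2 := by positivity
  -- Balls of radius ε/2 about separated points are disjoint and lie in the ball of radius 1 + ε/2;
  -- volumes are compared.
  have hdisj : (F : Set ι).Pairwise
      (Function.onFun Disjoint fun i => ball (f i) (ε / 2)) := by
    intro i hi j hj hij
    apply ball_disjoint_ball
    rw [dist_eq_norm, add_halves]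
    exact (h hi hj hij).le
  have hsub : (⋃ i ∈ F, ball (f i) (ε / 2)) ⊆ ball (0 : E) (1 + ε / 2) := by
    refine Set.iUnion₂_subset fun i _ => ball_subset_ball' ?_
    rw [dist_zero_right]
    linarith [hf i]
  have hvol : (F.card : ENNReal) * ENNReal.ofReal ((ε / 2) ^ finrank ℝ E) * μ (ball 0 1) ≤
      ENNReal.ofReal ((1 + ε / 2) ^ finrank ℝ E) * μ (ball 0 1) :=
    calc
      _ = μ (⋃ i ∈ F, ball (f i) (ε / 2)) := by
        rw [measure_biUnion_finset hdisj fun _ _ => measurableSet_ball]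
        simp only [μ.addHaar_ball_of_pos _ hε2, Finset.sum_const, nsmul_eq_mul, mul_assoc]
      _ ≤ μ (ball (0 : E) (1 + ε / 2)) := measure_mono hsub
      _ = _ := by rw [μ.addHaar_ball_of_pos _ hρ]
  have hcard := (ENNReal.mul_le_mul_iff_left (measure_ball_pos _ _ zero_lt_one).ne'
    measure_ball_lt_top.ne).1 hvol
  have hreal := ENNReal.toReal_le_of_le_ofReal (pow_nonneg hρ.le _) hcard
  rw [ENNReal.toReal_mul, ENNReal.toReal_natCast,
    ENNReal.toReal_ofReal (pow_nonneg hε2.le _)] at hreal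
  rw [← le_div_iff₀ (pow_pos hε2 _), ← div_pow] at hreal
  refine hreal.trans (le_of_eq ?_)
  congr 1
  field_simp
  ring

open Module in
/-- A family in the unit ball of a finite-dimensional space has a finite `ε`-net. -/
theorem exists_finset_net {E ι : Type*} [NormedAddCommGroup E] [NormedSpace ℝ E]
    [FiniteDimensional ℝ E] [Nonempty ι] (f : ι → E) (hf : ∀ i, ‖f i‖ ≤ 1) {ε : ℝ} (hε : 0 < ε) :
    ∃ F : Finset ι, F.Nonempty ∧ (F.card : ℝ) ≤ (1 + 2 / ε) ^ finrank ℝ E ∧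
      ∀ i, ∃ j ∈ F, ‖f i - f j‖ ≤ ε := by
  classical
  -- A separated family of largest cardinality is a net. Its points are indices in `ι`, so the net
  -- consists of actual parameters.
  set Q : ℕ → Prop := fun m => ∃ F : Finset ι, F.card = m ∧
    (F : Set ι).Pairwise fun i j => ε < ‖f i - f j‖ with hQ
  set M := ⌊(1 + 2 / ε) ^ finrank ℝ E⌋₊ with hM
  have hbound : ∀ m, Q m → m ≤ M := by
    rintro m ⟨F, rfl, hF⟩
    exact Nat.le_floor (card_le_of_separated f hf hε F hF)
  have h0 : Q 0 := ⟨∅, by simp⟩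
  obtain ⟨F, hcard, hF⟩ := Nat.findGreatest_spec (P := Q) (Nat.zero_le M) h0
  have hnet : ∀ i, ∃ j ∈ F, ‖f i - f j‖ ≤ ε := by
    intro i
    by_contra! hi
    have hiF : i ∉ F := fun h => by simpa using (hε.trans (hi i h)).ne'
    have hQ' : Q (F.card + 1) := by
      refine ⟨insert i F, Finset.card_insert_of_notMem hiF, ?_⟩
      rw [Finset.coe_insert, Set.pairwise_insert]
      refine ⟨hF, fun j hj _ => ⟨hi j hj, ?_⟩⟩
      rw [norm_sub_rev]
      exact hi j hj
    have := Nat.le_findGreatest (hbound _ hQ') hQ'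
    omega
  refine ⟨F, ?_, card_le_of_separated f hf hε F hF, hnet⟩
  obtain ⟨i⟩ := ‹Nonempty ι›
  obtain ⟨j, hj, _⟩ := hnet i
  exact ⟨j, hj⟩

/-! ### Operator norms and Lipschitz dependence on the gates -/

open scoped Kronecker Matrix MatrixOrder Matrix.Norms.L2Operator

theorem localOp_eq_submatrix {d N : ℕ} (s : Finset (Fin N))
    (u : Matrix ({i // i ∈ s} → Fin d) ({i // i ∈ s} → Fin d) ℂ) :
    localOp s u = (u ⊗ₖ (1 : Matrix ({i // i ∉ s} → Fin d) ({i // i ∉ s} → Fin d) ℂ)).submatrix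
      (Equiv.piEquivPiSubtypeProd (fun i => i ∈ s) fun _ => Fin d)
      (Equiv.piEquivPiSubtypeProd (fun i => i ∈ s) fun _ => Fin d) := by
  ext a b
  simp [localOp, Matrix.kroneckerMap_apply, Matrix.one_apply, funext_iff]

/-- `u ↦ u ⊗ 1` as a homomorphism of star algebras. -/
noncomputable def localOpHom (d : ℕ) {N : ℕ} (s : Finset (Fin N)) :
    Matrix ({i // i ∈ s} → Fin d) ({i // i ∈ s} → Fin d) ℂ →⋆ₐ[ℂ] Operator d N where
  toFun := localOp s
  map_one' := by rw [localOp_eq_submatrix, Matrix.one_kronecker_one, Matrix.submatrix_one_equiv]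
  map_mul' u v := by
    rw [localOp_eq_submatrix, localOp_eq_submatrix, localOp_eq_submatrix,
      Matrix.submatrix_mul_equiv, ← Matrix.mul_kronecker_mul, one_mul]
  map_zero' := by
    rw [localOp_eq_submatrix, Matrix.zero_kronecker, Matrix.submatrix_zero]
    rfl
  map_add' u v := by
    rw [localOp_eq_submatrix, localOp_eq_submatrix, localOp_eq_submatrix, Matrix.add_kronecker,
      Matrix.submatrix_add]
    rfl
  commutes' r := by
    rw [Algebra.algebraMap_eq_smul_one, Algebra.algebraMap_eq_smul_one, localOp_eq_submatrix,
      Matrix.smul_kronecker, Matrix.one_kronecker_one, Matrix.submatrix_smul]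
    simp
  map_star' u := by
    rw [localOp_eq_submatrix, localOp_eq_submatrix, Matrix.star_eq_conjTranspose,
      Matrix.star_eq_conjTranspose, Matrix.conjTranspose_submatrix,
      Matrix.conjTranspose_kronecker, Matrix.conjTranspose_one]

/-- Star homomorphisms between C⋆-algebras are contractive. Distances between gates can therefore be
measured on the few qudits they act on. -/
theorem norm_localOp_le {d N : ℕ} (s : Finset (Fin N))
    (u : Matrix ({i // i ∈ s} → Fin d) ({i // i ∈ s} → Fin d) ℂ) : ‖localOp s u‖ ≤ ‖u‖ :=
  NonUnitalStarAlgHom.norm_apply_le (localOpHom d s) u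

theorem localOp_sub {d N : ℕ} (s : Finset (Fin N))
    (u v : Matrix ({i // i ∈ s} → Fin d) ({i // i ∈ s} → Fin d) ℂ) :
    localOp s (u - v) = localOp s u - localOp s v :=
  map_sub (localOpHom d s) u v

/-- By the C⋆-identity ‖u‖² = ‖1‖. Equality to 1 fails over an empty index type. -/
theorem norm_unitary_le_one {ι : Type*} [Fintype ι] [DecidableEq ι]
    (u : Matrix.unitaryGroup ι ℂ) : ‖(u : Matrix ι ι ℂ)‖ ≤ 1 := by
  have h : star (u : Matrix ι ι ℂ) * u = 1 := Unitary.coe_star_mul_self u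
  have h1 : ‖(1 : Matrix ι ι ℂ)‖ ≤ 1 := by
    rw [Matrix.cstar_norm_def, map_one]
    exact ContinuousLinearMap.norm_id_le
  rw [← h, CStarRing.norm_star_mul_self] at h1
  nlinarith [norm_nonneg (u : Matrix ι ι ℂ)]

theorem norm_list_prod_le_one {R : Type*} [NormedRing R] (h1 : ‖(1 : R)‖ ≤ 1) {n : ℕ}
    (a : Fin n → R) (ha : ∀ i, ‖a i‖ ≤ 1) : ‖(List.ofFn a).prod‖ ≤ 1 := by
  induction n with
  | zero => simpa using h1
  | succ n ih =>
    rw [List.ofFn_succ, List.prod_cons]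
    exact (norm_mul_le _ _).trans
      (mul_le_one₀ (ha 0) (norm_nonneg _) (ih _ fun i => ha i.succ))

/-- Products of contractions are Lipschitz in their factors. -/
theorem norm_list_prod_sub_le {R : Type*} [NormedRing R] (h1 : ‖(1 : R)‖ ≤ 1) {n : ℕ}
    (a b : Fin n → R) (ha : ∀ i, ‖a i‖ ≤ 1) (hb : ∀ i, ‖b i‖ ≤ 1) :
    ‖(List.ofFn a).prod - (List.ofFn b).prod‖ ≤ ∑ i, ‖a i - b i‖ := by
  induction n with
  | zero => simp
  | succ n ih =>
    rw [List.ofFn_succ, List.prod_cons, List.ofFn_succ, List.prod_cons, Fin.sum_univ_succ]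
    set A := (List.ofFn fun i : Fin n => a i.succ).prod
    set B := (List.ofFn fun i : Fin n => b i.succ).prod
    have hA : ‖A‖ ≤ 1 := norm_list_prod_le_one h1 _ fun i => ha i.succ
    have hAB : ‖A - B‖ ≤ ∑ i : Fin n, ‖a i.succ - b i.succ‖ :=
      ih _ _ (fun i => ha i.succ) fun i => hb i.succ
    have heq : a 0 * A - b 0 * B = (a 0 - b 0) * A + b 0 * (A - B) := by noncomm_ring
    rw [heq]
    refine (norm_add_le _ _).trans (add_le_add ?_ ?_)
    · exact (norm_mul_le _ _).trans (mul_le_of_le_one_right (norm_nonneg _) hA)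
    · exact (norm_mul_le _ _).trans
        ((mul_le_of_le_one_left (norm_nonneg _) (hb 0)).trans hAB)

variable {d N k Ng : ℕ} {Θ X : Type*}

theorem norm_one_le_one : ‖(1 : Operator d N)‖ ≤ 1 :=
  norm_unitary_le_one (1 : Matrix.unitaryGroup (Basis d N) ℂ)

theorem Ansatz.norm_circuit_le_one (c : Ansatz d N k Ng Θ) (θ : Θ) : ‖c.circuit θ‖ ≤ 1 :=
  norm_list_prod_le_one norm_one_le_one _ fun _ =>
    (norm_localOp_le _ _).trans (norm_unitary_le_one _)

/-- Fixed gates contribute zero to the telescoping sum, so N_gt appears and not N_g. -/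
theorem Ansatz.norm_circuit_sub_le (c : Ansatz d N k Ng Θ) (θ θ' : Θ) {ε : ℝ}
    (h : ∀ l ∈ c.trainable, ‖(c.gate l θ).1 - (c.gate l θ').1‖ ≤ ε) :
    ‖c.circuit θ - c.circuit θ'‖ ≤ c.numTrainable * ε := by
  refine (norm_list_prod_sub_le norm_one_le_one _ _
    (fun _ => (norm_localOp_le _ _).trans (norm_unitary_le_one _))
    fun _ => (norm_localOp_le _ _).trans (norm_unitary_le_one _)).trans ?_
  rw [← Finset.sum_subset (Finset.subset_univ c.trainable), Ansatz.numTrainable, ← nsmul_eq_mul]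
  · refine Finset.sum_le_card_nsmul _ _ _ fun l hl => ?_
    rw [← localOp_sub]
    exact (norm_localOp_le _ _).trans (h l hl)
  · intro l _ hl
    rw [c.fixed l hl θ θ', sub_self, norm_zero]

theorem opNorm_eq_norm (O : Operator d N) : opNorm O = ‖O‖ := rfl

/-- The pairing of an operator with a state is bounded by the operator norm. -/
theorem norm_trace_mul_le (A ρ : Operator d N) (hρ : IsState ρ) : ‖(A * ρ).trace‖ ≤ ‖A‖ := by
  obtain ⟨B, rfl⟩ : ∃ B : Operator d N, ρ = Bᴴ * B := by
    exact CStarAlgebra.nonneg_iff_eq_star_mul_self.mp hρ.1.nonneg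
  -- The columns of Bᴴ, so that ρ is the sum of the rank-one operators |v i⟩⟨v i| and the trace is a
  -- sum of quadratic forms.
  set v : Basis d N → EuclideanSpace ℂ (Basis d N) := fun i => WithLp.toLp 2 (star (B i)) with hv
  have htr : ∀ M : Operator d N, (M * (Bᴴ * B)).trace =
      ∑ i, inner ℂ (v i) (Matrix.toEuclideanCLM (n := Basis d N) (𝕜 := ℂ) M (v i)) := by
    intro M
    rw [← Matrix.mul_assoc, Matrix.trace_mul_comm, ← Matrix.mul_assoc, Matrix.trace]
    refine Finset.sum_congr rfl fun i _ => ?_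
    rw [hv, Matrix.toEuclideanCLM_toLp, EuclideanSpace.inner_toLp_toLp, star_star,
      dotProduct_comm, Matrix.diag_apply, Matrix.mul_assoc, Matrix.mul_apply']
    rfl
  have hsum : ∑ i, ‖v i‖ ^ 2 = 1 := by
    have h1 := htr 1
    rw [one_mul, hρ.2, map_one] at h1
    simp only [one_apply_eq_self, inner_self_eq_norm_sq_to_K] at h1
    exact Complex.ofReal_injective (by push_cast; exact h1.symm)
  rw [htr]
  calc _ ≤ ∑ i, ‖A‖ * ‖v i‖ ^ 2 := by
        refine norm_sum_le_of_le _ fun i _ => ?_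
        refine (norm_inner_le_norm _ _).trans ?_
        have := (Matrix.toEuclideanCLM (n := Basis d N) (𝕜 := ℂ) A).le_opNorm (v i)
        rw [← Matrix.cstar_norm_def] at this
        nlinarith [norm_nonneg (v i)]
    _ = ‖A‖ := by rw [← Finset.mul_sum, hsum, mul_one]

theorem abs_hypothesis_le (c : Ansatz d N k Ng Θ) (O : Operator d N) {ρ : X → Operator d N}
    (hρ : ∀ x, IsState (ρ x)) (θ : Θ) (x : X) : |hypothesis c O ρ θ x| ≤ opNorm O := by
  refine (Complex.abs_re_le_norm _).trans ((norm_trace_mul_le _ _ (hρ x)).trans ?_)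
  rw [opNorm_eq_norm]
  have hU := c.norm_circuit_le_one θ
  have hU' : ‖(c.circuit θ)ᴴ‖ ≤ 1 := by rwa [Matrix.l2_opNorm_conjTranspose]
  refine (norm_mul_le _ _).trans ((mul_le_of_le_one_right (norm_nonneg _) hU).trans ?_)
  exact (norm_mul_le _ _).trans (mul_le_of_le_one_left (norm_nonneg _) hU')

/-- The circuit occurs twice in Uᴴ O U; changing one occurrence at a time gives the factor 2. -/
theorem abs_hypothesis_sub_le (c : Ansatz d N k Ng Θ) (O : Operator d N) {ρ : X → Operator d N}
    (hρ : ∀ x, IsState (ρ x)) (θ θ' : Θ) {ε : ℝ}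
    (h : ∀ l ∈ c.trainable, ‖(c.gate l θ).1 - (c.gate l θ').1‖ ≤ ε) (x : X) :
    |hypothesis c O ρ θ x - hypothesis c O ρ θ' x| ≤ 2 * opNorm O * (c.numTrainable * ε) := by
  have hsub := c.norm_circuit_sub_le θ θ' h
  set U := c.circuit θ with hUdef
  set V := c.circuit θ' with hVdef
  have hU : ‖U‖ ≤ 1 := c.norm_circuit_le_one θ
  have hV : ‖Vᴴ‖ ≤ 1 := by
    rw [Matrix.l2_opNorm_conjTranspose]
    exact c.norm_circuit_le_one θ'
  have heq : hypothesis c O ρ θ x - hypothesis c O ρ θ' x =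
      (((Uᴴ * O * U - Vᴴ * O * V) * ρ x).trace).re := by
    rw [sub_mul, Matrix.trace_sub, Complex.sub_re]
    rfl
  rw [heq, opNorm_eq_norm]
  refine (Complex.abs_re_le_norm _).trans ((norm_trace_mul_le _ _ (hρ x)).trans ?_)
  have hdec : Uᴴ * O * U - Vᴴ * O * V = (U - V)ᴴ * O * U + Vᴴ * O * (U - V) := by
    rw [Matrix.conjTranspose_sub]
    noncomm_ring
  have h1 : ‖(U - V)ᴴ * O * U‖ ≤ ‖O‖ * ‖U - V‖ := by
    refine (norm_mul_le _ _).trans ((mul_le_of_le_one_right (norm_nonneg _) hU).trans ?_)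
    refine (norm_mul_le _ _).trans (le_of_eq ?_)
    rw [Matrix.l2_opNorm_conjTranspose, mul_comm]
  have h2 : ‖Vᴴ * O * (U - V)‖ ≤ ‖O‖ * ‖U - V‖ := by
    refine (norm_mul_le _ _).trans (mul_le_mul_of_nonneg_right ?_ (norm_nonneg _))
    exact (norm_mul_le _ _).trans (mul_le_of_le_one_left (norm_nonneg _) hV)
  rw [hdec]
  refine (norm_add_le _ _).trans ((add_le_add h1 h2).trans ?_)
  nlinarith [norm_nonneg O, mul_le_mul_of_nonneg_left hsub (norm_nonneg O)]

theorem measurable_hypothesis [MeasurableSpace X] (c : Ansatz d N k Ng Θ) (O : Operator d N)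
    {ρ : X → Operator d N} (hρ : ∀ a b, Measurable fun x => ρ x a b) (θ : Θ) :
    Measurable (hypothesis c O ρ θ) := by
  unfold hypothesis
  refine Complex.measurable_re.comp ?_
  simp only [Matrix.trace, Matrix.diag_apply, Matrix.mul_apply (N := ρ _)]
  exact Finset.measurable_fun_sum _ fun a _ => Finset.measurable_fun_sum _ fun b _ =>
    (hρ b a).const_mul _

/-! ### Nets of circuits and their entropy -/

/-- The trainable gates of a circuit have a finite net of controlled cardinality. -/
theorem Ansatz.exists_net [Nonempty Θ] (hd : 1 ≤ d) (c : Ansatz d N k Ng Θ) {ε : ℝ} (hε : 0 < ε) :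
    ∃ F : Finset Θ, F.Nonempty ∧
      (F.card : ℝ) ≤ (1 + 2 / ε) ^ (2 * (c.numTrainable * (d ^ k) ^ 2)) ∧
      ∀ θ, ∃ θ' ∈ F, ∀ l ∈ c.trainable, ‖(c.gate l θ).1 - (c.gate l θ').1‖ ≤ ε := by
  -- The sup over trainable gates of the operator norms; fixed gates add no dimension.
  set E := ∀ l : c.trainable, Matrix ({i // i ∈ c.support l} → Fin d)
    ({i // i ∈ c.support l} → Fin d) ℂ with hE
  set f : Θ → E := fun θ l => (c.gate l θ).1 with hf
  have hf1 : ∀ θ, ‖f θ‖ ≤ 1 := fun θ =>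
    (pi_norm_le_iff_of_nonneg zero_le_one).mpr fun _ => norm_unitary_le_one _
  obtain ⟨F, hF, hcard, hnet⟩ := exists_finset_net f hf1 hε
  refine ⟨F, hF, hcard.trans ?_, fun θ => ?_⟩
  · refine pow_le_pow_right₀ (by linarith [div_pos two_pos hε]) ?_
    have h1 : Module.finrank ℝ E = 2 * Module.finrank ℂ E := finrank_real_of_complex E
    rw [h1]
    refine Nat.mul_le_mul_left 2 ?_
    rw [Module.finrank_pi_fintype]
    refine (Finset.sum_le_card_nsmul _ _ ((d ^ k) ^ 2) fun l _ => ?_).trans ?_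
    · rw [Module.finrank_matrix]
      simp only [Fintype.card_pi, Fintype.card_fin, Finset.prod_const, Finset.card_univ,
        Fintype.card_coe, Module.finrank_self, mul_one]
      rw [← sq]
      exact Nat.pow_le_pow_left (Nat.pow_le_pow_right hd (c.card_support_le l)) 2
    · simp [Ansatz.numTrainable]
  · obtain ⟨θ', hθ', h⟩ := hnet θ
    exact ⟨θ', hθ', fun l hl => (norm_le_pi_norm (f θ - f θ') ⟨l, hl⟩).trans h⟩

/-- The generalization gap is Lipschitz in the loss profile with respect to the sup norm. -/
theorem integral_sub_mean_le {Z : Type*} [MeasurableSpace Z] (μ : Measure Z)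
    [IsProbabilityMeasure μ] {n : ℕ} (hn : 1 ≤ n) {f g : Z → ℝ} (hf : Integrable f μ)
    (hg : Integrable g μ) {κ : ℝ} (h : ∀ z, |f z - g z| ≤ κ) (S : Fin n → Z) :
    ∫ z, f z ∂μ - (1 / (n : ℝ)) * ∑ i, f (S i) ≤
      (∫ z, g z ∂μ - (1 / (n : ℝ)) * ∑ i, g (S i)) + 2 * κ := by
  have hn0 : (0 : ℝ) < n := by exact_mod_cast hn
  have h1 : ∫ z, f z ∂μ ≤ ∫ z, g z ∂μ + κ := by
    have := integral_mono hf (hg.add (integrable_const κ))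
      fun z => by simpa using sub_le_iff_le_add'.mp (abs_le.mp (h z)).2
    simpa [integral_add hg (integrable_const κ)] using this
  have h2 : (1 / (n : ℝ)) * ∑ i, g (S i) ≤ (1 / (n : ℝ)) * ∑ i, f (S i) + κ := by
    have : ∑ i, g (S i) ≤ ∑ i, f (S i) + n * κ := by
      have := Finset.sum_le_sum fun (i : Fin n) (_ : i ∈ Finset.univ) =>
        (by linarith [(abs_le.mp (h (S i))).1] : g (S i) ≤ f (S i) + κ)
      simpa [Finset.sum_add_distrib] using this
    calc _ ≤ (1 / (n : ℝ)) * (∑ i, f (S i) + n * κ) := by gcongr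
      _ = _ := by field_simp
  linarith

/-- The metric entropy of the net of radius `2 / t`. -/
theorem sqrt_log_card_le {m g D : ℕ} {t : ℝ} (ht : 0 ≤ t) (hm : 1 ≤ m)
    (h : (m : ℝ) ≤ (1 + t) ^ (2 * (g * D ^ 2))) :
    4 * √(Real.log m) ≤ 24 * (D * √g) * (max 0 (Real.log (7 * t)) + 1) := by
  set l := max 0 (Real.log (7 * t)) + 1 with hl
  have hl1 : 1 ≤ l := by linarith [le_max_left 0 (Real.log (7 * t))]
  have hlog : Real.log (1 + t) ≤ l := by
    rcases le_total t 1 with h1 | h1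
    · have := Real.log_le_log (by linarith) (by linarith : 1 + t ≤ 2)
      linarith [Real.log_two_lt_d9]
    · have := Real.log_le_log (by linarith) (by linarith : 1 + t ≤ 7 * t)
      linarith [le_max_right 0 (Real.log (7 * t))]
  have hm0 : (0 : ℝ) < m := by exact_mod_cast hm
  have hbound : Real.log m ≤ 2 * (g * D ^ 2) * l ^ 2 := by
    refine (Real.log_le_log hm0 h).trans ?_
    rw [Real.log_pow]
    push_cast
    -- Since l ≥ 1, log(1 + t) ≤ l ≤ l², which lets the square root come out linear in l.
    exact mul_le_mul_of_nonneg_left (by nlinarith) (by positivity)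
  have hsq : √(Real.log m) ≤ 6 * (D * √g) * l := by
    refine Real.sqrt_le_iff.mpr ⟨by positivity, hbound.trans ?_⟩
    have hg := Real.sq_sqrt (Nat.cast_nonneg (α := ℝ) g)
    calc (2 * (g * D ^ 2) * l ^ 2 : ℝ) ≤ 36 * (g * D ^ 2) * l ^ 2 := by gcongr; norm_num
      _ = (6 * (D * √g) * l) ^ 2 := by rw [mul_pow, mul_pow, mul_pow, hg]; ring
  linarith

/-- A finite net of the hypothesis class at the resolution `4 / √n`, and its entropy. -/
theorem Ansatz.exists_hypothesis_net {d N k Ng n : ℕ} (hd : 1 ≤ d) (hn : 1 ≤ n) {Θ X : Type*}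
    [Nonempty Θ] (c : Ansatz d N k Ng Θ) (O : Operator d N) {ρ : X → Operator d N}
    (hρ : ∀ x, IsState (ρ x)) :
    ∃ F : Finset Θ, F.Nonempty ∧
      4 * √(Real.log F.card) ≤ 24 * ((d : ℝ) ^ k * √c.numTrainable) *
        (max 0 (Real.log (7 * √n * c.numTrainable * opNorm O)) + 1) ∧
      ∀ θ, ∃ θ' ∈ F, ∀ x, |hypothesis c O ρ θ x - hypothesis c O ρ θ' x| ≤ 4 / √n := by
  have hn0 : (0 : ℝ) < √n := Real.sqrt_pos.mpr (by exact_mod_cast hn)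
  have hO0 : 0 ≤ opNorm O := norm_nonneg _
  set t : ℝ := √n * c.numTrainable * opNorm O with ht
  have ht0 : 0 ≤ t := by positivity
  have h7 : 7 * √n * c.numTrainable * opNorm O = 7 * t := by rw [ht]; ring
  -- If t = 0, there is no trainable gate or O = 0, so the hypothesis does not depend on θ and one
  -- point is a net.
  rcases ht0.eq_or_lt with h0 | hpos
  · obtain ⟨θ₀⟩ := ‹Nonempty Θ›
    refine ⟨{θ₀}, Finset.singleton_nonempty _, ?_, fun θ => ⟨θ₀, by simp, fun x => ?_⟩⟩
    · simp only [Finset.card_singleton, Nat.cast_one, Real.log_one, Real.sqrt_zero, mul_zero]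
      positivity
    · have h := abs_hypothesis_sub_le c O hρ θ θ₀ (ε := 2) (fun l _ =>
        (norm_sub_le_of_le (norm_unitary_le_one _) (norm_unitary_le_one _)).trans
          one_add_one_eq_two.le) x
      have hz : opNorm O * c.numTrainable = 0 := by
        have : √n * (opNorm O * c.numTrainable) = 0 := by rw [h0, ht]; ring
        exact (mul_eq_zero.mp this).resolve_left hn0.ne'
      have hz' : 2 * opNorm O * (c.numTrainable * 2) = 0 := by
        rw [show 2 * opNorm O * ((c.numTrainable : ℝ) * 2) = 4 * (opNorm O * c.numTrainable) by
          ring, hz, mul_zero]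
      exact h.trans (hz'.le.trans (by positivity))
  -- The radius solves 2‖O‖ · N_gt · ε = 4/√n.
  · obtain ⟨F, hF, hcard, hnet⟩ := c.exists_net hd (ε := 2 / t) (by positivity)
    refine ⟨F, hF, ?_, fun θ => ?_⟩
    · rw [h7]
      have h := sqrt_log_card_le (m := F.card) (g := c.numTrainable) (D := d ^ k) ht0 hF.card_pos
        (by simpa using hcard)
      simpa using h
    · obtain ⟨θ', hθ', h⟩ := hnet θ
      refine ⟨θ', hθ', fun x => (abs_hypothesis_sub_le c O hρ θ θ' h x).trans (le_of_eq ?_)⟩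
      have h1 : opNorm O ≠ 0 := by rintro h; simp [ht, h] at hpos
      have h2 : (c.numTrainable : ℝ) ≠ 0 := by rintro h; simp [ht, h] at hpos
      rw [ht]
      field_simp
      norm_num

end QNN

/-! ### The generalization bound -/

open ProbabilityTheory in
theorem theorem2
    {d N k Ng n : ℕ} (hd : 1 ≤ d) (hn : 1 ≤ n)
    {Θ X Y : Type*} [MeasurableSpace X] [MeasurableSpace Y]
    -- the circuit, the observable, and the encoding of data into states
    (c : QNN.Ansatz d N k Ng Θ)
    (O : QNN.Operator d N) (hO : O.IsHermitian)
    (ρ : X → QNN.Operator d N) (hρ : ∀ x, QNN.IsState (ρ x))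
    (hρ_meas : ∀ a b, Measurable fun x => ρ x a b)
    -- the data distribution
    (μ : Measure (X × Y)) [IsProbabilityMeasure μ]
    -- the loss, Lipschitz and bounded on the range of the hypotheses
    (loss : ℝ → Y → ℝ) (hloss_meas : Measurable (Function.uncurry loss))
    (L₁ : NNReal) (C₁ : ℝ)
    (hlip : ∀ y, LipschitzOnWith L₁ (fun t => loss t y)
      (Set.Icc (-QNN.opNorm O) (QNN.opNorm O)))
    (hbdd : ∀ y, ∀ t ∈ Set.Icc (-QNN.opNorm O) (QNN.opNorm O), |loss t y| ≤ C₁)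
    (δ : ℝ) (hδ0 : 0 < δ) (hδ1 : δ < 1) :
    ∃ E : Set (Fin n → X × Y), MeasurableSet E ∧
      ENNReal.ofReal (1 - δ) ≤ (Measure.pi fun _ : Fin n => μ) E ∧
      ∀ S ∈ E, ∀ A : (Fin n → X × Y) → Θ,
        QNN.expectedRisk μ loss (QNN.hypothesis c O ρ (A S))
            - QNN.empiricalRisk S loss (QNN.hypothesis c O ρ (A S))
          ≤ 8 * (L₁ : ℝ) / Real.sqrt n
            + 24 * (L₁ : ℝ) / Real.sqrt n * ((d : ℝ) ^ k * Real.sqrt c.numTrainable)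
                * (max 1 (QNN.opNorm O)
                  * (max 0 (Real.log (7 * Real.sqrt n * c.numTrainable * QNN.opNorm O)) + 1))
            + 3 * C₁ * Real.sqrt (Real.log (1 / δ) / (2 * n)) := by
  set P := Measure.pi fun _ : Fin n => μ with hP
  have htriv : ENNReal.ofReal (1 - δ) ≤ P Set.univ := by
    rw [measure_univ]
    exact ENNReal.ofReal_le_one.mpr (by linarith)
  rcases isEmpty_or_nonempty Θ with hΘ | hΘ
  · exact ⟨Set.univ, MeasurableSet.univ, htriv, fun S _ A => (hΘ.false (A S)).elim⟩
  have hM0 : 0 ≤ QNN.opNorm O := norm_nonneg _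
  have hn0 : (0 : ℝ) < √n := Real.sqrt_pos.mpr (by exact_mod_cast hn)
  set h := QNN.hypothesis c O ρ with hh
  have hmem : ∀ θ x, h θ x ∈ Set.Icc (-QNN.opNorm O) (QNN.opNorm O) := fun θ x =>
    abs_le.mp (QNN.abs_hypothesis_le c O hρ θ x)
  have h0mem : (0 : ℝ) ∈ Set.Icc (-QNN.opNorm O) (QNN.opNorm O) := ⟨by linarith, hM0⟩
  have hC0 : 0 ≤ C₁ := by
    obtain ⟨z⟩ := nonempty_of_isProbabilityMeasure μ
    exact (abs_nonneg _).trans (hbdd z.2 0 h0mem)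
  -- The tail bound needs a positive parameter; for C₁ = 0 all losses vanish.
  rcases hC0.eq_or_lt with hCz | hCpos
  · refine ⟨Set.univ, MeasurableSet.univ, htriv, fun S _ A => ?_⟩
    have hz : ∀ θ (z : X × Y), loss (h θ z.1) z.2 = 0 := fun θ z =>
      abs_nonpos_iff.mp (hCz ▸ hbdd z.2 _ (hmem θ z.1))
    simp only [QNN.expectedRisk, QNN.empiricalRisk, hz, integral_zero, Finset.sum_const_zero,
      mul_zero, sub_zero, ← hCz, zero_mul, add_zero]
    positivity
  set C : NNReal := ⟨C₁, hC0⟩ with hC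
  set f : Θ → X × Y → ℝ := fun θ z => loss (h θ z.1) z.2 with hf
  set f₀ : X × Y → ℝ := fun z => loss 0 z.2 with hf₀
  have hfm : ∀ θ, Measurable (f θ) := fun θ => hloss_meas.comp
    (((QNN.measurable_hypothesis c O hρ_meas θ).comp measurable_fst).prodMk measurable_snd)
  have hf₀m : Measurable f₀ := hloss_meas.comp (measurable_const.prodMk measurable_snd)
  have hfC : ∀ θ z, |f θ z| ≤ C := fun θ z => hbdd z.2 _ (hmem θ z.1)
  have hf₀C : ∀ z, |f₀ z| ≤ C := fun z => hbdd z.2 0 h0mem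
  have hint : ∀ {g : X × Y → ℝ}, Measurable g → (∀ z, |g z| ≤ C) → Integrable g μ :=
    fun hg hb => Integrable.of_bound hg.aestronglyMeasurable (C : ℝ)
      (Filter.Eventually.of_forall hb)
  have hlipf : ∀ s ∈ Set.Icc (-QNN.opNorm O) (QNN.opNorm O),
      ∀ t ∈ Set.Icc (-QNN.opNorm O) (QNN.opNorm O), ∀ y,
      |loss s y - loss t y| ≤ L₁ * |s - t| := fun s hs t ht y => by
    simpa [Real.dist_eq] using (hlip y).dist_le_mul s hs t ht
  set b : NNReal := L₁ * ⟨max 1 (QNN.opNorm O), by positivity⟩ with hb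
  have hbr : (b : ℝ) = L₁ * max 1 (QNN.opNorm O) := rfl
  have hfb : ∀ θ z, |f θ z - f₀ z| ≤ b := fun θ z => by
    refine (hlipf _ (hmem θ z.1) 0 h0mem z.2).trans ?_
    rw [hbr, sub_zero]
    exact mul_le_mul_of_nonneg_left
      ((QNN.abs_hypothesis_le c O hρ θ z.1).trans (le_max_right _ _)) L₁.coe_nonneg
  obtain ⟨F, hF, hbF, hent, hnet⟩ : ∃ F : Finset Θ, F.Nonempty ∧ (0 < b ∨ F.card = 1) ∧
      4 * √(Real.log F.card) ≤ 24 * ((d : ℝ) ^ k * √c.numTrainable) *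
        (max 0 (Real.log (7 * √n * c.numTrainable * QNN.opNorm O)) + 1) ∧
      ∀ θ, ∃ θ' ∈ F, ∀ x, L₁ * |h θ x - h θ' x| ≤ L₁ * (4 / √n) := by
    -- For L₁ = 0 the loss is constant on the range, so a single point serves as net and b = 0 is
    -- harmless.
    rcases eq_zero_or_pos L₁ with hL | hL
    · obtain ⟨θ₀⟩ := hΘ
      refine ⟨{θ₀}, Finset.singleton_nonempty _, Or.inr (Finset.card_singleton _), ?_,
        fun θ => ⟨θ₀, by simp, fun x => by simp [hL]⟩⟩
      simp only [Finset.card_singleton, Nat.cast_one, Real.log_one, Real.sqrt_zero, mul_zero]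
      positivity
    · obtain ⟨F, hF, hent, hnet⟩ := c.exists_hypothesis_net (n := n) hd hn O hρ
      refine ⟨F, hF, Or.inl (mul_pos hL ?_), hent, fun θ => ?_⟩
      · exact lt_of_lt_of_le zero_lt_one (le_max_left (1 : ℝ) _)
      · obtain ⟨θ', hθ', hx⟩ := hnet θ
        exact ⟨θ', hθ', fun x => mul_le_mul_of_nonneg_left (hx x) L₁.coe_nonneg⟩
  set gap : (X × Y → ℝ) → (Fin n → X × Y) → ℝ :=
    fun g S => ∫ z, g z ∂μ - (1 / (n : ℝ)) * ∑ i, g (S i) with hgap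
  have hgapm : ∀ {g}, Measurable g → Measurable (gap g) := fun hg =>
    measurable_const.sub (Measurable.const_mul
      (Finset.measurable_fun_sum _ fun i _ => hg.comp (measurable_pi_apply i)) _)
  have hsplit : ∀ θ S, gap (f θ) S = gap f₀ S + gap (fun z => f θ z - f₀ z) S := by
    intro θ S
    simp only [hgap]
    rw [integral_sub (hint (hfm θ) (hfC θ)) (hint hf₀m hf₀C), Finset.sum_sub_distrib]
    ring
  have hnn : 0 < NNReal.sqrt n := NNReal.sqrt_pos.mpr (by exact_mod_cast hn)
  have htail := QNN.measureReal_exists_gt_le (P := P) F hF (C := C / NNReal.sqrt n)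
    (b := b / NNReal.sqrt n) (G := gap f₀) (Z := fun θ => gap fun z => f θ z - f₀ z)
    (div_pos hCpos hnn) (hbF.imp_left fun hb => div_pos hb hnn)
    (QNN.hasSubgaussianMGF_integral_sub_mean μ hn hf₀m hf₀C)
    (fun θ _ => QNN.hasSubgaussianMGF_integral_sub_mean μ hn ((hfm θ).sub hf₀m) (hfb θ))
    (fun θ _ => by
      have := QNN.hasSubgaussianMGF_integral_sub_mean μ hn (hfm θ) (hfC θ)
      rwa [show (fun S : Fin n → X × Y => ∫ z, f θ z ∂μ - (1 / (n : ℝ)) * ∑ i, f θ (S i)) =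
        _ from funext (hsplit θ)] at this) hδ0 hδ1
  simp only [← hsplit] at htail
  set s : ℝ := 4 * ((b / NNReal.sqrt n : NNReal) : ℝ) * √(Real.log F.card) +
    3 / 2 * ((C / NNReal.sqrt n : NNReal) : ℝ) * √(2 * Real.log (1 / δ)) with hs
  have hbadm : MeasurableSet {S | ∃ θ ∈ F, s ≤ gap (f θ) S} := by
    have : {S | ∃ θ ∈ F, s ≤ gap (f θ) S} = ⋃ θ ∈ F, {S | s ≤ gap (f θ) S} := by
      ext S
      simp
    rw [this]
    exact Finset.measurableSet_biUnion _ fun θ _ => measurableSet_le measurable_const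
      (hgapm (hfm θ))
  -- The event involves only the finite net, so it is measurable and serves every algorithm at once.
  refine ⟨{S | ∃ θ ∈ F, s ≤ gap (f θ) S}ᶜ, hbadm.compl, ?_, fun S hS A => ?_⟩
  · rw [← ofReal_measureReal, probReal_compl_eq_one_sub hbadm]
    exact ENNReal.ofReal_le_ofReal (by linarith)
  obtain ⟨θ', hθ', hx⟩ := hnet (A S)
  have hlt : gap (f θ') S < s := by
    by_contra hle
    exact hS ⟨θ', hθ', not_lt.mp hle⟩
  have hcmp : gap (f (A S)) S ≤ gap (f θ') S + 2 * (L₁ * (4 / √n)) :=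
    QNN.integral_sub_mean_le μ hn (hint (hfm _) (hfC _)) (hint (hfm _) (hfC _))
      (fun z => (hlipf _ (hmem _ _) _ (hmem _ _) z.2).trans (hx z.1)) S
  have hconf : 3 / 2 * ((C / NNReal.sqrt n : NNReal) : ℝ) * √(2 * Real.log (1 / δ)) =
      3 * C₁ * √(Real.log (1 / δ) / (2 * n)) := by
    have : Real.log (1 / δ) / (2 * n) = 2 * Real.log (1 / δ) / (2 ^ 2 * n) := by
      field_simp
    rw [this, Real.sqrt_div' _ (by positivity), Real.sqrt_mul (by positivity : (0 : ℝ) ≤ 2 ^ 2),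
      Real.sqrt_sq zero_le_two, NNReal.coe_div, Real.coe_sqrt, NNReal.coe_natCast]
    change 3 / 2 * (C₁ / √n) * _ = _
    field_simp
  have hcomp : 4 * ((b / NNReal.sqrt n : NNReal) : ℝ) * √(Real.log F.card) ≤
      24 * (L₁ : ℝ) / √n * ((d : ℝ) ^ k * √c.numTrainable) * (max 1 (QNN.opNorm O) *
        (max 0 (Real.log (7 * √n * c.numTrainable * QNN.opNorm O)) + 1)) := by
    rw [NNReal.coe_div, Real.coe_sqrt, NNReal.coe_natCast, hbr]
    have := mul_le_mul_of_nonneg_left hent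
      (by positivity : 0 ≤ L₁ * max 1 (QNN.opNorm O) / √n)
    refine (le_of_eq ?_).trans (this.trans (le_of_eq ?_)) <;> ring
  have hdisc : 2 * (L₁ * (4 / √n)) = 8 * (L₁ : ℝ) / √n := by ring
  change gap (f (A S)) S ≤ _
  linarith
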